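/- Consider a status update system with $m\ge 1$ sources in which one packet is sent at a time. After the delivery of packet $i$ at time $D_i$ ($D_0=0$) a sampler chooses, on the basis of the history and possibly at random, a waiting time $Z_i$ from a finite set $\mathcal Z\subset[0,\infty)$ with $0\in\mathcal Z$. Packet $i+1$ is generated at time $D_i+Z_i$ and delivered at time $D_{i+1}=D_i+Z_i+Y_{i+1}$, where the service times $Y_i$ are i.i.d. with values in a finite set $\mathcal Y\subset[0,\infty)$, have the law of $Y$ with $\mathbb E[Y]>0$, and each is independent of the past and of the preceding waiting time. Packets are scheduled Maximum Age First (MAF): packet $i+1$ comes from a source of maximum age at time $D_i$, ties being broken arbitrarily. The age $\Delta_l(t)$ of source $l$ is $t$ minus the generation time of its most recently generated packet delivered by time $t$; the initial ages are given and non-negative. The total average age of a sampler $f$ is $$\Delta_{\rm avg}(f)=\limsup_{n\to\infty}\frac{\mathbb E\big[\sum_{l=1}^m\int_0^{D_n}\Delta_l(t)\,dt\big]}{\mathbb E[D_n]},$$ and $\bar\Delta=\inf_f\Delta_{\rm avg}(f)$ is its optimal value. The state $\mathbf s=(a_{[1]},\dots,a_{[m]})$ at a delivery time lists the ages in decreasing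 order; $\mathcal S$ is the set of all possible states, and $A_{\mathbf s}=\sum_l a_{[l]}$. After waiting time $z$ and service time $y$ the next state is $\mathbf s'(z,y)=(a_{[2]}+z+y,\dots,a_{[m]}+z+y,\,y)$. Put $$C(\mathbf s,z)=\mathbb E\Big[(A_{\mathbf s}-\bar\Delta)(z+Y)+\frac m2(z+Y)^2\Big]$$ and consider Bellman's equation $$\lambda+h(\mathbf s)=\min_{z\in\mathcal Z}\Big[C(\mathbf s,z)+\mathbb E\,h(\mathbf s'(z,Y))\Big],\qquad \mathbf s\in\mathcal S,$$ in a scalar $\lambda$ and a function $h$. A waiting time that attains this minimum is called optimal in the state $\mathbf s$. Then Bellman's equation has a solution, and for every solution $(\lambda,h)$: (i) each stationary deterministic sampler that uses in every state $\mathbf s\in\mathcal S$ a waiting time that is optimal in $\mathbf s$ minimizes $\Delta_{\rm avg}$ over all samplers; (ii) in every state $\mathbf s\in\mathcal S$ with $A_{\mathbf s}\ge\bar\Delta-m\,\mathbb E[Y]$ the optimal waiting time is zero, that is, $z=0$ attains the minimum in Bellman's equation, and no other $z\in\mathcal Z$ does. -/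

import Mathlib

/-- A multi-source status update system: `m ≥ 1` sources, i.i.d. service times with finite set of
values `𝒴 ⊆ [0, ∞)`, law `p` and positive mean, and a finite set `𝒵 ⊆ [0, ∞)` of waiting times
that contains the zero wait. -/
structure UpdateSystem where
  m : ℕ
  m_pos : 0 < m
  𝒴 : Finset ℝ
  𝒴_nonneg : ∀ y ∈ 𝒴, 0 ≤ y
  p : ℝ → ℝ
  p_nonneg : ∀ y ∈ 𝒴, 0 ≤ p y
  p_sum : ∑ y ∈ 𝒴, p y = 1
  mean_pos : 0 < ∑ y ∈ 𝒴, p y * y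
  𝒵 : Finset ℝ
  𝒵_nonneg : ∀ z ∈ 𝒵, 0 ≤ z
  zero_mem : (0 : ℝ) ∈ 𝒵

namespace UpdateSystem

/-- `𝔼[Y]`. -/
noncomputable def meanY (M : UpdateSystem) : ℝ := ∑ y ∈ M.𝒴, M.p y * y

/-- The history of the first `n` stages, most recent stage first:
`[(Z_{n-1}, Y_n), …, (Z_0, Y_1)]`. -/
abbrev History : Type := List (ℝ × ℝ)

/-- All waiting times and service times of the history are admissible. -/
def Feasible (M : UpdateSystem) (H : History) : Prop :=
  ∀ x ∈ H, x.1 ∈ M.𝒵 ∧ x.2 ∈ M.𝒴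

/-- The delivery time `D_n` of the last packet of the history (`D_0 = 0`). -/
noncomputable def deliveryTime : History → ℝ
  | [] => 0
  | (z, y) :: H => deliveryTime H + z + y

/-- A causal scheduling strategy: the source served after the given history. -/
abbrev Scheduler (M : UpdateSystem) : Type := History → Fin M.m

/-- `U_l(t)`, the generation time of the most recently generated packet of source `l` that has been
delivered by time `t`. A packet that is sent after the history `H` with waiting time `z` is
generated at `D + z`, where `D` is the delivery time of `H`. Before the first delivery from source
`l`, `-U_l` is the initial age `a₀ l` of this source. -/
noncomputable def lastGen (M : UpdateSystem) (a₀ : Fin M.m → ℝ) (sched : M.Scheduler) :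
    History → Fin M.m → ℝ → ℝ
  | [], l, _ => -a₀ l
  | (z, y) :: H, l, t =>
      open Classical in
      if deliveryTime ((z, y) :: H) ≤ t ∧ l = sched H then deliveryTime H + z
      else lastGen M a₀ sched H l t

/-- The age `Δ_l(t) = t - U_l(t)`. -/
noncomputable def age (M : UpdateSystem) (a₀ : Fin M.m → ℝ) (sched : M.Scheduler)
    (H : History) (l : Fin M.m) (t : ℝ) : ℝ :=
  t - M.lastGen a₀ sched H l t

/-- Maximum Age First: after each delivery a source of maximum age is served; ties are broken
arbitrarily. -/
def IsMAF (M : UpdateSystem) (a₀ : Fin M.m → ℝ) (sched : M.Scheduler) : Prop :=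
  ∀ H : History, M.Feasible H → ∀ l : Fin M.m,
    M.age a₀ sched H l (deliveryTime H) ≤ M.age a₀ sched H (sched H) (deliveryTime H)

/-- A causal (history-dependent, possibly randomized) sampling strategy: `prob H z` is the
conditional probability of the waiting time `z`, given the history `H`. -/
structure Sampler (M : UpdateSystem) where
  prob : History → ℝ → ℝ
  prob_nonneg : ∀ H, ∀ z ∈ M.𝒵, 0 ≤ prob H z
  prob_sum : ∀ H, ∑ z ∈ M.𝒵, prob H z = 1

/-- `𝔼[F(H_n)]`, where `H_n` is the random history of the first `n` stages under the sampler `f`;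
each service time is independent of the history and of the waiting time that precedes it. -/
noncomputable def expect (M : UpdateSystem) (f : M.Sampler) : ℕ → (History → ℝ) → ℝ
  | 0, F => F []
  | n + 1, F => M.expect f n (fun H =>
      ∑ z ∈ M.𝒵, f.prob H z * ∑ y ∈ M.𝒴, M.p y * F ((z, y) :: H))

/-- The total average age per unit time of the scheduler `sched` and the sampler `f`. -/
noncomputable def taa (M : UpdateSystem) (a₀ : Fin M.m → ℝ) (sched : M.Scheduler)
    (f : M.Sampler) : ℝ :=
  Filter.limsup (fun n : ℕ =>
    M.expect f n (fun H => ∑ l : Fin M.m, ∫ t in (0 : ℝ)..deliveryTime H, M.age a₀ sched H l t) /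
      M.expect f n deliveryTime) Filter.atTop

/-- The optimal total average age per unit time over all samplers, for a fixed scheduler. -/
noncomputable def taaOpt (M : UpdateSystem) (a₀ : Fin M.m → ℝ) (sched : M.Scheduler) : ℝ :=
  ⨅ f : M.Sampler, M.taa a₀ sched f

/-- The sampler `f` solves the sampling problem. -/
def IsOptimalSampler (M : UpdateSystem) (a₀ : Fin M.m → ℝ) (sched : M.Scheduler)
    (f : M.Sampler) : Prop :=
  ∀ g : M.Sampler, M.taa a₀ sched f ≤ M.taa a₀ sched g

/-- The system state after a history: the ages of the sources at the last delivery time, in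
decreasing order. -/
noncomputable def state (M : UpdateSystem) (a₀ : Fin M.m → ℝ) (sched : M.Scheduler)
    (H : History) : Fin M.m → ℝ :=
  let a : Fin M.m → ℝ := fun l => M.age a₀ sched H l (deliveryTime H)
  fun i => a (Tuple.sort a (Fin.rev i))

/-- The state space: all possible states. -/
def stateSpace (M : UpdateSystem) (a₀ : Fin M.m → ℝ) (sched : M.Scheduler) :
    Set (Fin M.m → ℝ) :=
  {s | ∃ H : History, M.Feasible H ∧ M.state a₀ sched H = s}

/-- The sampler that waits for the time `μ s` whenever the state is `s`. -/
noncomputable def stationary (M : UpdateSystem) (a₀ : Fin M.m → ℝ) (sched : M.Scheduler)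
    (μ : (Fin M.m → ℝ) → {z : ℝ // z ∈ M.𝒵}) : M.Sampler where
  prob H z := open Classical in if z = (μ (M.state a₀ sched H) : ℝ) then 1 else 0
  prob_nonneg H z _ := by
    split_ifs <;> norm_num
  prob_sum H := by
    classical
    rw [Finset.sum_ite_eq' M.𝒵 _ (fun _ => (1 : ℝ)), if_pos (μ (M.state a₀ sched H)).2]

/-- The successor of the state `s` after the waiting time `z` and the service time `y`: the last
(smallest) age becomes `y`, and each other one is the next age of `s`, increased by `z + y`. -/
noncomputable def next (M : UpdateSystem) (s : Fin M.m → ℝ) (z y : ℝ) : Fin M.m → ℝ :=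
  fun i => if h : (i : ℕ) + 1 < M.m then s ⟨(i : ℕ) + 1, h⟩ + z + y else y

/-- The expected cost per stage `C(s, z)`, with the parameter `β` in the role of the optimal total
average age. -/
noncomputable def cost (M : UpdateSystem) (β : ℝ) (s : Fin M.m → ℝ) (z : ℝ) : ℝ :=
  ∑ y ∈ M.𝒴, M.p y *
    ((∑ l, s l - β) * (z + y) + (M.m : ℝ) / 2 * (z ^ 2 + 2 * z * y + y ^ 2))

/-- The expression `C(s, z) + ∑_{s'} P_{s s'}(z) h(s')` that Bellman's equation minimizes. -/
noncomputable def bellmanRHS (M : UpdateSystem) (β : ℝ) (h : (Fin M.m → ℝ) → ℝ)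
    (s : Fin M.m → ℝ) (z : ℝ) : ℝ :=
  M.cost β s z + ∑ y ∈ M.𝒴, M.p y * h (M.next s z y)

/-- Bellman's equation `lam + h(s) = min_{z ∈ 𝒵} (C(s, z) + ∑_{s'} P_{s s'}(z) h(s'))` on the state
space `S`. -/
def Bellman (M : UpdateSystem) (β : ℝ) (S : Set (Fin M.m → ℝ)) (lam : ℝ)
    (h : (Fin M.m → ℝ) → ℝ) : Prop :=
  ∀ s ∈ S, IsLeast (M.bellmanRHS β h s '' (M.𝒵 : Set ℝ)) (lam + h s)

/-- `z` is an optimal waiting time in the state `s`: it attains the minimum in Bellman's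
equation. -/
def IsOptimalWait (M : UpdateSystem) (β : ℝ) (h : (Fin M.m → ℝ) → ℝ)
    (s : Fin M.m → ℝ) (z : ℝ) : Prop :=
  z ∈ M.𝒵 ∧ ∀ w ∈ M.𝒵, M.bellmanRHS β h s z ≤ M.bellmanRHS β h s w

end UpdateSystem

/-! Under Maximum Age First the largest age is replaced by `y`, which becomes the smallest, while
all others grow by `z + y`. The sorted ages thus form a shift register: after `m` deliveries nothing
is left of the initial state. This loss of memory has three uses. It makes the state space finite
(`finite_stateSpace`). It bounds the span of discounted value functions uniformly in the discount
factor, so a vanishing-discount limit solves Bellman's equation (`exists_bellman`). And it lets a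
finite induction prove that every solution `h` is monotone (`Bellman.monotone`): the smaller state
copies the wait that is optimal in the larger one until the two states coincide.

Zero wait: by monotonicity the future value does not decrease in `z`, while the cost exceeds that of
`z = 0` by `z * (A_s - β + m * E[Y]) + m / 2 * z ^ 2`, which is positive above the threshold
(`Bellman.bellmanRHS_zero_lt`).

Optimality: accumulated age minus `β * D_n` plus `h` of the state (`potential`) has drift at least
`lam` under every sampler and at most `lam` under a minimizing stationary one. Since `h` is bounded
on the states, `lam > 0` would keep all samplers above the infimum `β` by a fixed margin. So `lam ≤
0` (`Bellman.lam_nonpos`), and the minimizing sampler has average at most `β`. -/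

open Filter Topology

/-! ### Average cost optimality equation by vanishing discount -/

section AverageCost

variable {S A W : Type*} [Fintype A] [Nonempty A] [Fintype W]

/-- The discounted dynamic programming operator of a finite Markov decision process with one-stage
cost `c`, transition function `T`, noise law `p` and discount factor `α`. -/
noncomputable def dpOperator (c : S → A → ℝ) (T : S → A → W → S) (p : W → ℝ) (α : ℝ)
    (v : S → ℝ) (s : S) : ℝ :=
  Finset.univ.inf' Finset.univ_nonempty (fun a => c s a + α * ∑ w, p w * v (T s a w))

variable {c : S → A → ℝ} {T : S → A → W → S} {p : W → ℝ}

theorem dpOperator_le (α : ℝ) (v : S → ℝ) (s : S) (a : A) :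
    dpOperator c T p α v s ≤ c s a + α * ∑ w, p w * v (T s a w) :=
  Finset.inf'_le (fun a => c s a + α * ∑ w, p w * v (T s a w)) (Finset.mem_univ a)

theorem exists_dpOperator_eq (α : ℝ) (v : S → ℝ) (s : S) :
    ∃ a, dpOperator c T p α v s = c s a + α * ∑ w, p w * v (T s a w) := by
  obtain ⟨a, -, h⟩ := Finset.exists_mem_eq_inf' (s := Finset.univ) Finset.univ_nonempty
    (fun a => c s a + α * ∑ w, p w * v (T s a w))
  exact ⟨a, h⟩

theorem sum_weight_le (hp : ∀ w, 0 ≤ p w) (hp1 : ∑ w, p w = 1) {u : W → ℝ} {b : ℝ}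
    (hu : ∀ w, u w ≤ b) : ∑ w, p w * u w ≤ b := by
  calc ∑ w, p w * u w ≤ ∑ w, p w * b :=
        Finset.sum_le_sum fun w _ => mul_le_mul_of_nonneg_left (hu w) (hp w)
    _ = b := by rw [← Finset.sum_mul, hp1, one_mul]

theorem dpOperator_sub_le [Fintype S] (hp : ∀ w, 0 ≤ p w) (hp1 : ∑ w, p w = 1) {α : ℝ} (hα : 0 ≤ α)
    (u v : S → ℝ) (s : S) :
    dpOperator c T p α u s - dpOperator c T p α v s ≤ α * dist u v := by
  obtain ⟨a, ha⟩ := exists_dpOperator_eq (c := c) (T := T) (p := p) α v s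
  have h1 := dpOperator_le (c := c) (T := T) (p := p) α u s a
  have h2 : ∑ w, p w * (u (T s a w) - v (T s a w)) ≤ dist u v :=
    sum_weight_le hp hp1 fun w =>
      (le_abs_self _).trans (by rw [← Real.dist_eq]; exact dist_le_pi_dist u v _)
  have h3 := mul_le_mul_of_nonneg_left h2 hα
  simp only [mul_sub, Finset.sum_sub_distrib] at h3
  linarith

theorem exists_dpOperator_fixedPoint [Fintype S] (c : S → A → ℝ) (T : S → A → W → S) (hp : ∀ w, 0 ≤ p w)
    (hp1 : ∑ w, p w = 1) {α : ℝ} (hα : 0 ≤ α) (hα1 : α < 1) :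
    ∃ v : S → ℝ, dpOperator c T p α v = v := by
  have hc : ContractingWith ⟨α, hα⟩ (dpOperator c T p α) := by
    refine ⟨by exact_mod_cast hα1, LipschitzWith.of_dist_le_mul fun u v => ?_⟩
    refine (dist_pi_le_iff (by positivity)).2 fun s => ?_
    rw [Real.dist_eq, abs_sub_le_iff]
    refine ⟨dpOperator_sub_le hp hp1 hα u v s, ?_⟩
    rw [dist_comm u v]
    exact dpOperator_sub_le hp hp1 hα v u s
  exact ⟨_, hc.fixedPoint_isFixedPt⟩

/-- If the transitions forget the initial state after `N` stages, the span of a discounted value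
function is bounded uniformly in the discount factor. -/
theorem sub_le_of_forgetting (hp : ∀ w, 0 ≤ p w) (hp1 : ∑ w, p w = 1) {α : ℝ} (hα : 0 ≤ α)
    (hα1 : α ≤ 1) {K : ℝ} (hK : ∀ s s' a, c s a - c s' a ≤ K) (hK0 : 0 ≤ K)
    {N : ℕ} {E : ℕ → S → S → Prop} (hEN : ∀ s s', E N s s' → s = s')
    (hE : ∀ k s s' a w, E k s s' → E (k + 1) (T s a w) (T s' a w))
    {v : S → ℝ} (hv : dpOperator c T p α v = v) (j : ℕ) :
    ∀ k, k + j = N → ∀ s s', E k s s' → v s - v s' ≤ j * K := by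
  induction j with
  | zero =>
    rintro k rfl s s' h
    simp [hEN s s' h]
  | succ j ih =>
    intro k hk s s' h
    -- Coupling: `s` copies the action optimal in `s'` and sees the same noise, so each stage costs
    -- at most `K` more until the states merge.
    obtain ⟨a, ha⟩ := exists_dpOperator_eq (c := c) (T := T) (p := p) α v s'
    have h1 := dpOperator_le (c := c) (T := T) (p := p) α v s a
    rw [hv] at h1 ha
    have h2 : ∑ w, p w * (v (T s a w) - v (T s' a w)) ≤ j * K :=
      sum_weight_le hp hp1 fun w => ih (k + 1) (by omega) _ _ (hE k s s' a w h)
    have h3 : α * ∑ w, p w * (v (T s a w) - v (T s' a w)) ≤ j * K :=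
      (mul_le_mul_of_nonneg_left h2 hα).trans
        (mul_le_of_le_one_left (by positivity) hα1)
    simp only [mul_sub, Finset.sum_sub_distrib] at h3
    have h4 := hK s s' a
    push_cast
    linarith

/-- The average cost optimality equation of a finite Markov decision process whose transitions
forget the initial state after `N` stages has a solution. -/
theorem exists_average_cost_solution [Nonempty S] [Fintype S] (c : S → A → ℝ) (T : S → A → W → S)
    (hp : ∀ w, 0 ≤ p w) (hp1 : ∑ w, p w = 1) {N : ℕ} {E : ℕ → S → S → Prop}
    (hE0 : ∀ s s', E 0 s s') (hEN : ∀ s s', E N s s' → s = s')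
    (hE : ∀ k s s' a w, E k s s' → E (k + 1) (T s a w) (T s' a w)) :
    ∃ (g : ℝ) (h : S → ℝ), ∀ s, g + h s = dpOperator c T p 1 h s := by
  obtain ⟨K, hK⟩ : ∃ K : ℝ, ∀ s a, |c s a| ≤ K := by
    obtain ⟨K, hK⟩ := Finite.exists_le (fun x : S × A => |c x.1 x.2|)
    exact ⟨K, fun s a => hK (s, a)⟩
  let s₀ : S := Classical.arbitrary S
  have hK0 : 0 ≤ K := (abs_nonneg _).trans (hK s₀ (Classical.arbitrary A))
  -- The discounted values may diverge as the discount factor tends to 1, but `(1 - α) * v s₀` and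
  -- the differences `v s - v s₀` stay in a fixed ball.
  have key : ∀ n : ℕ, ∃ x : ℝ × (S → ℝ), x ∈ Metric.closedBall 0 (K + N * (2 * K)) ∧
      ∀ s, x.1 + x.2 s = dpOperator c T p (1 - 1 / ((n : ℝ) + 1)) x.2 s := by
    intro n
    have hn : 0 < 1 / ((n : ℝ) + 1) := by positivity
    have hn1 : 1 / ((n : ℝ) + 1) ≤ 1 := by
      rw [div_le_one (by positivity)]
      linarith [(Nat.cast_nonneg n : (0 : ℝ) ≤ n)]
    set α := 1 - 1 / ((n : ℝ) + 1) with hα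
    have h0 : 0 ≤ α := by linarith
    have h1 : α < 1 := by linarith
    obtain ⟨v, hv⟩ := exists_dpOperator_fixedPoint c T hp hp1 h0 h1
    have hspan : ∀ s s', v s - v s' ≤ N * (2 * K) := fun s s' =>
      sub_le_of_forgetting hp hp1 h0 h1.le (K := 2 * K)
        (fun s s' a => by linarith [abs_le.1 (hK s a), abs_le.1 (hK s' a)])
        (by positivity) hEN hE hv N 0 (by omega) s s' (hE0 s s')
    have hshift : ∀ s, v s = dpOperator c T p α (fun s => v s - v s₀) s + α * v s₀ := by
      intro s
      have e : ∀ a, α * ∑ w, p w * (v (T s a w) - v s₀) =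
          α * ∑ w, p w * v (T s a w) - α * v s₀ := by
        intro a
        simp only [mul_sub, Finset.sum_sub_distrib, ← Finset.sum_mul, hp1, one_mul]
      apply le_antisymm
      · obtain ⟨a, ha⟩ := exists_dpOperator_eq (c := c) (T := T) (p := p) α
          (fun s => v s - v s₀) s
        have h1 := dpOperator_le (c := c) (T := T) (p := p) α v s a
        rw [hv] at h1
        rw [ha, e]
        linarith
      · obtain ⟨a, ha⟩ := exists_dpOperator_eq (c := c) (T := T) (p := p) α v s
        have h1 := dpOperator_le (c := c) (T := T) (p := p) α (fun s => v s - v s₀) s a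
        rw [hv] at ha
        rw [e] at h1
        linarith
    refine ⟨((1 - α) * v s₀, fun s => v s - v s₀), ?_, fun s => ?_⟩
    · rw [mem_closedBall_zero_iff, norm_prod_le_iff]
      have hNK : 0 ≤ (N : ℝ) * (2 * K) := by positivity
      refine ⟨?_, ?_⟩
      · obtain ⟨a, ha⟩ := exists_dpOperator_eq (c := c) (T := T) (p := p) α
          (fun s => v s - v s₀) s₀
        have e1 : (1 - α) * v s₀ = c s₀ a + α * ∑ w, p w * (v (T s₀ a w) - v s₀) := by
          linarith [hshift s₀]
        have b1 : ∑ w, p w * (v (T s₀ a w) - v s₀) ≤ N * (2 * K) :=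
          sum_weight_le hp hp1 fun w => hspan _ _
        have b2 : ∑ w, p w * (v s₀ - v (T s₀ a w)) ≤ N * (2 * K) :=
          sum_weight_le hp hp1 fun w => hspan _ _
        have b3 : ∑ w, p w * (v s₀ - v (T s₀ a w)) = -∑ w, p w * (v (T s₀ a w) - v s₀) := by
          rw [← Finset.sum_neg_distrib]
          exact Finset.sum_congr rfl fun w _ => by ring
        have b4 : |∑ w, p w * (v (T s₀ a w) - v s₀)| ≤ N * (2 * K) :=
          abs_le.2 ⟨by linarith, b1⟩
        change |(1 - α) * v s₀| ≤ _
        rw [e1]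
        refine (abs_add_le _ _).trans (add_le_add (hK _ _) ?_)
        rw [abs_mul, abs_of_nonneg h0]
        exact (mul_le_of_le_one_left (abs_nonneg _) h1.le).trans b4
      · refine (pi_norm_le_iff_of_nonneg (by positivity)).2 fun s => ?_
        change |v s - v s₀| ≤ _
        exact abs_le.2 ⟨by linarith [hspan s₀ s], by linarith [hspan s s₀]⟩
    · change (1 - α) * v s₀ + (v s - v s₀) = _
      linarith [hshift s]
  choose x hxB hx using key
  -- With finitely many states the ball is compact; with finitely many actions the minimum passes to
  -- the limit.
  obtain ⟨⟨g, h⟩, -, φ, hφ, hlim⟩ := tendsto_subseq_of_bounded Metric.isBounded_closedBall hxB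
  refine ⟨g, h, fun s => ?_⟩
  have hg : Tendsto (fun n => (x (φ n)).1) atTop (𝓝 g) :=
    (continuous_fst.tendsto _).comp hlim
  have hh : ∀ s, Tendsto (fun n => (x (φ n)).2 s) atTop (𝓝 (h s)) := fun s =>
    (((continuous_apply s).comp continuous_snd).tendsto _).comp hlim
  have hα : Tendsto (fun n => 1 - 1 / ((φ n : ℝ) + 1)) atTop (𝓝 1) := by
    simpa using (tendsto_const_nhds (x := (1 : ℝ))).sub
      (tendsto_one_div_add_atTop_nhds_zero_nat.comp hφ.tendsto_atTop)
  refine tendsto_nhds_unique (hg.add (hh s)) ?_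
  simp only [hx]
  refine Tendsto.finset_inf'_nhds_apply Finset.univ_nonempty fun a _ => ?_
  exact tendsto_const_nhds.add
    (hα.mul (tendsto_finsetSum _ fun w _ => tendsto_const_nhds.mul (hh _)))

end AverageCost

/-! ### Decreasing rearrangements -/

/-- Ties make the sorting permutation ambiguous but not the sorted values, so any convenient
permutation may be used. -/
theorem comp_sort_rev_eq {n : ℕ} (a : Fin n → ℝ) (σ : Equiv.Perm (Fin n))
    (h : Antitone (a ∘ σ)) (i : Fin n) : a (Tuple.sort a (Fin.rev i)) = a (σ i) := by
  have h1 : Antitone (a ∘ (Fin.revPerm.trans (Tuple.sort a))) := fun i j hij =>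
    Tuple.monotone_sort a (Fin.rev_le_rev.2 hij)
  exact congrFun (Tuple.unique_antitone h1 h) i

theorem antitone_sort_rev {n : ℕ} (a : Fin n → ℝ) :
    Antitone fun i => a (Tuple.sort a (Fin.rev i)) := fun _ _ hij =>
  Tuple.monotone_sort a (Fin.rev_le_rev.2 hij)

/-- Resetting a maximal entry to a value below all others and shifting the others by a constant
rotates the decreasing rearrangement. -/
theorem sort_rev_reset {n : ℕ} (a : Fin n → ℝ) (q : Fin n) (hq : ∀ l, a l ≤ a q) {w y : ℝ}
    (hy : ∀ l, y ≤ a l + w) {a' : Fin n → ℝ} (ha' : ∀ l, a' l = if l = q then y else a l + w)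
    (i : Fin n) :
    a' (Tuple.sort a' (Fin.rev i)) =
      if h : (i : ℕ) + 1 < n then a (Tuple.sort a (Fin.rev ⟨(i : ℕ) + 1, h⟩)) + w else y := by
  obtain _ | k := n
  · exact i.elim0
  set b : Fin (k + 1) → ℝ := fun i => a (Tuple.sort a (Fin.rev i)) with hb
  have hb_anti : Antitone b := antitone_sort_rev a
  obtain ⟨σ, hσ, hσ0⟩ : ∃ σ : Equiv.Perm (Fin (k + 1)), (∀ i, a (σ i) = b i) ∧ σ 0 = q := by
    set τ : Equiv.Perm (Fin (k + 1)) := Fin.revPerm.trans (Tuple.sort a) with hτ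
    have hτb : ∀ i, a (τ i) = b i := fun i => rfl
    have hmax : a (τ 0) = a q := by
      apply le_antisymm (hq _)
      have := hb_anti (Fin.zero_le (τ.symm q))
      rw [← hτb, ← hτb, Equiv.apply_symm_apply] at this
      exact this
    -- Under a tie the sort may put another maximal index first; swapping it with `q` changes no
    -- value.
    refine ⟨τ.trans (Equiv.swap (τ 0) q), fun i => ?_, by simp⟩
    rw [← hτb, Equiv.trans_apply]
    by_cases h1 : τ i = τ 0
    · rw [h1, Equiv.swap_apply_left, hmax]
    by_cases h2 : τ i = q
    · rw [h2, Equiv.swap_apply_right, hmax]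
    · rw [Equiv.swap_apply_of_ne_of_ne h1 h2]
  have hval : ∀ i : Fin (k + 1), a' (σ (finRotate (k + 1) i)) =
      if h : (i : ℕ) + 1 < k + 1 then b ⟨(i : ℕ) + 1, h⟩ + w else y := by
    intro i
    by_cases h : (i : ℕ) + 1 < k + 1
    · have e : finRotate (k + 1) i = ⟨(i : ℕ) + 1, h⟩ := by
        ext
        exact coe_finRotate_of_ne_last fun h' => by simp [h'] at h
      have hne : σ ⟨(i : ℕ) + 1, h⟩ ≠ q := by
        rw [← hσ0]
        intro h'
        have := congrArg Fin.val (σ.injective h')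
        simp at this
      rw [dif_pos h, e, ha', if_neg hne, hσ]
    · have e : i = Fin.last k := by
        ext
        simp only [Fin.val_last]
        omega
      rw [dif_neg h, e, finRotate_last, hσ0, ha', if_pos rfl]
  -- The rotation sends the last position to 0, so the reset entry `q = σ 0` comes last and the
  -- others move up by one.
  rw [comp_sort_rev_eq a' ((finRotate (k + 1)).trans σ) ?_ i]
  · exact hval i
  · intro i j hij
    simp only [Function.comp_apply, Equiv.trans_apply, hval]
    have hij' : (i : ℕ) ≤ j := hij
    by_cases hj : (j : ℕ) + 1 < k + 1
    · rw [dif_pos hj, dif_pos (by omega)]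
      have : b ⟨(j : ℕ) + 1, hj⟩ ≤ b ⟨(i : ℕ) + 1, by omega⟩ :=
        hb_anti (Fin.mk_le_mk.2 (by omega))
      linarith
    · rw [dif_neg hj]
      split_ifs with hi
      · exact hy _
      · exact le_rfl

/-! ### Ages and states at delivery times -/

namespace UpdateSystem

variable {M : UpdateSystem} {a₀ : Fin M.m → ℝ} {sched : M.Scheduler}

theorem feasible_nil : M.Feasible [] := by simp [Feasible]

theorem feasible_cons {z y : ℝ} {H : History} :
    M.Feasible ((z, y) :: H) ↔ (z ∈ M.𝒵 ∧ y ∈ M.𝒴) ∧ M.Feasible H := by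
  simp only [Feasible, List.forall_mem_cons]

theorem Feasible.deliveryTime_nonneg : ∀ {H : History}, M.Feasible H → 0 ≤ deliveryTime H
  | [], _ => le_rfl
  | (z, y) :: H, hH => by
    obtain ⟨⟨hz, hy⟩, hH⟩ := feasible_cons.1 hH
    have := hH.deliveryTime_nonneg
    have := M.𝒵_nonneg z hz
    have := M.𝒴_nonneg y hy
    simp only [deliveryTime]
    linarith

/-- No packet is delivered after the last delivery of the history. -/
theorem lastGen_of_deliveryTime_le (a₀ : Fin M.m → ℝ) (sched : M.Scheduler) (l : Fin M.m) :
    ∀ {H : History} {t : ℝ}, M.Feasible H → deliveryTime H ≤ t →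
      M.lastGen a₀ sched H l t = M.lastGen a₀ sched H l (deliveryTime H)
  | [], _, _, _ => rfl
  | (z, y) :: H, t, hH, ht => by
    obtain ⟨⟨hz, hy⟩, hH⟩ := feasible_cons.1 hH
    have hz := M.𝒵_nonneg z hz
    have hy := M.𝒴_nonneg y hy
    have hle : deliveryTime H ≤ deliveryTime ((z, y) :: H) := by
      simp only [deliveryTime]
      linarith
    by_cases hl : l = sched H
    · simp only [lastGen, hl, and_true, ht, le_refl, if_true]
    · simp only [lastGen, hl, and_false, if_false]
      rw [lastGen_of_deliveryTime_le a₀ sched l hH (hle.trans ht),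
        lastGen_of_deliveryTime_le a₀ sched l hH hle]

theorem age_of_deliveryTime_le (a₀ : Fin M.m → ℝ) (sched : M.Scheduler) (l : Fin M.m)
    {H : History} {t : ℝ} (hH : M.Feasible H) (ht : deliveryTime H ≤ t) :
    M.age a₀ sched H l t = M.age a₀ sched H l (deliveryTime H) + (t - deliveryTime H) := by
  rw [age, age, lastGen_of_deliveryTime_le a₀ sched l hH ht]
  ring

theorem age_cons (a₀ : Fin M.m → ℝ) (sched : M.Scheduler) {H : History} {z y : ℝ}
    (hH : M.Feasible ((z, y) :: H)) (l : Fin M.m) :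
    M.age a₀ sched ((z, y) :: H) l (deliveryTime ((z, y) :: H)) =
      if l = sched H then y else M.age a₀ sched H l (deliveryTime H) + (z + y) := by
  obtain ⟨⟨hz, hy⟩, hH⟩ := feasible_cons.1 hH
  have hz := M.𝒵_nonneg z hz
  have hy := M.𝒴_nonneg y hy
  split_ifs with hl
  · simp only [age, lastGen, hl, and_true, le_refl, if_true, deliveryTime]
    ring
  · have h1 : M.age a₀ sched ((z, y) :: H) l (deliveryTime ((z, y) :: H)) =
        M.age a₀ sched H l (deliveryTime ((z, y) :: H)) := by
      simp only [age, lastGen, hl, and_false, if_false]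
    rw [h1, age_of_deliveryTime_le a₀ sched l hH (by simp only [deliveryTime]; linarith)]
    simp only [deliveryTime]
    ring

theorem age_nonneg (ha₀ : ∀ l, 0 ≤ a₀ l) (sched : M.Scheduler) (l : Fin M.m) :
    ∀ {H : History}, M.Feasible H → 0 ≤ M.age a₀ sched H l (deliveryTime H)
  | [], _ => by simpa [age, lastGen, deliveryTime] using ha₀ l
  | (z, y) :: H, hH => by
    rw [age_cons a₀ sched hH]
    obtain ⟨⟨hz, hy⟩, hH⟩ := feasible_cons.1 hH
    have hz := M.𝒵_nonneg z hz
    have hy := M.𝒴_nonneg y hy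
    have := age_nonneg ha₀ sched l hH
    split_ifs <;> linarith

theorem state_nonneg (ha₀ : ∀ l, 0 ≤ a₀ l) {H : History} (hH : M.Feasible H) (i : Fin M.m) :
    0 ≤ M.state a₀ sched H i :=
  age_nonneg ha₀ sched _ hH

/-- Under Maximum Age First the states follow the transition function. -/
theorem state_cons (ha₀ : ∀ l, 0 ≤ a₀ l) (hsched : M.IsMAF a₀ sched) {H : History} {z y : ℝ}
    (hH : M.Feasible ((z, y) :: H)) :
    M.state a₀ sched ((z, y) :: H) = M.next (M.state a₀ sched H) z y := by
  have hH' := (feasible_cons.1 hH).2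
  have hz := M.𝒵_nonneg z (feasible_cons.1 hH).1.1
  funext i
  simp only [state]
  rw [sort_rev_reset (fun l => M.age a₀ sched H l (deliveryTime H)) (sched H) (hsched H hH')
    (w := z + y) (y := y) (fun l => ?_) (age_cons a₀ sched hH)]
  · simp only [next, add_assoc]
  · have := age_nonneg ha₀ sched l hH'
    linarith

theorem sum_state (a₀ : Fin M.m → ℝ) (sched : M.Scheduler) (H : History) :
    ∑ i, M.state a₀ sched H i = ∑ l, M.age a₀ sched H l (deliveryTime H) :=
  Equiv.sum_comp (Fin.revPerm.trans (Tuple.sort _))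
    (fun l => M.age a₀ sched H l (deliveryTime H))

theorem state_mem_stateSpace {H : History} (hH : M.Feasible H) :
    M.state a₀ sched H ∈ M.stateSpace a₀ sched :=
  ⟨H, hH, rfl⟩

theorem next_mem_stateSpace (ha₀ : ∀ l, 0 ≤ a₀ l) (hsched : M.IsMAF a₀ sched)
    {s : Fin M.m → ℝ} (hs : s ∈ M.stateSpace a₀ sched) {z y : ℝ} (hz : z ∈ M.𝒵) (hy : y ∈ M.𝒴) :
    M.next s z y ∈ M.stateSpace a₀ sched := by
  obtain ⟨H, hH, rfl⟩ := hs
  have hH' : M.Feasible ((z, y) :: H) := feasible_cons.2 ⟨⟨hz, hy⟩, hH⟩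
  exact ⟨_, hH', state_cons ha₀ hsched hH'⟩

/-! ### Loss of memory and finiteness of the state space -/

/-- The last `k` entries of the two states agree. -/
def Agree (M : UpdateSystem) (k : ℕ) (s s' : Fin M.m → ℝ) : Prop :=
  ∀ i : Fin M.m, M.m ≤ i + k → s i = s' i

theorem agree_zero (s s' : Fin M.m → ℝ) : M.Agree 0 s s' := fun i hi =>
  absurd i.2 (by omega)

theorem Agree.eq {s s' : Fin M.m → ℝ} (h : M.Agree M.m s s') : s = s' :=
  funext fun i => h i (by omega)

theorem Agree.next {k : ℕ} {s s' : Fin M.m → ℝ} (h : M.Agree k s s') (z y : ℝ) :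
    M.Agree (k + 1) (M.next s z y) (M.next s' z y) := by
  intro i hi
  simp only [UpdateSystem.next]
  split_ifs with hlt
  · rw [h ⟨i + 1, hlt⟩ (by simp only; omega)]
  · rfl

/-- Histories list the most recent stage first, so `take k` keeps the last `k` stages, restarted
from the initial ages. -/
theorem agree_take (ha₀ : ∀ l, 0 ≤ a₀ l) (hsched : M.IsMAF a₀ sched) (k : ℕ) :
    ∀ {H : History}, M.Feasible H → k ≤ H.length →
      M.Agree k (M.state a₀ sched H) (M.state a₀ sched (H.take k)) := by
  induction k with
  | zero => exact fun _ _ => agree_zero _ _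
  | succ k ih =>
    rintro (_ | ⟨⟨z, y⟩, H⟩) hH hk
    · simp at hk
    · have hH' := feasible_cons.1 hH
      have ht : M.Feasible ((z, y) :: H.take k) :=
        feasible_cons.2 ⟨hH'.1, fun x hx => hH'.2 x (List.mem_of_mem_take hx)⟩
      rw [List.take_succ_cons, state_cons ha₀ hsched hH, state_cons ha₀ hsched ht]
      exact (ih hH'.2 (by simpa using hk)).next z y

theorem finite_feasible_length_le (M : UpdateSystem) (n : ℕ) :
    {H : History | M.Feasible H ∧ H.length ≤ n}.Finite := by
  induction n with
  | zero =>
    refine (Set.finite_singleton ([] : History)).subset ?_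
    rintro H ⟨-, hH⟩
    simpa using hH
  | succ n ih =>
    refine ((Set.finite_singleton ([] : History)).union (Set.Finite.image2 List.cons
      ((M.𝒵 ×ˢ M.𝒴).finite_toSet) ih)).subset ?_
    rintro (_ | ⟨⟨z, y⟩, H⟩) ⟨hH, hl⟩
    · exact Or.inl rfl
    · have hH' := feasible_cons.1 hH
      exact Or.inr ⟨(z, y), by simpa using hH'.1, H, ⟨hH'.2, by simpa using hl⟩, rfl⟩

theorem finite_stateSpace (ha₀ : ∀ l, 0 ≤ a₀ l) (hsched : M.IsMAF a₀ sched) :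
    (M.stateSpace a₀ sched).Finite := by
  refine ((M.finite_feasible_length_le M.m).image (M.state a₀ sched)).subset ?_
  rintro s ⟨H, hH, rfl⟩
  rcases le_total H.length M.m with hl | hl
  · exact ⟨H, ⟨hH, hl⟩, rfl⟩
  · exact ⟨H.take M.m, ⟨fun x hx => hH x (List.mem_of_mem_take hx), List.length_take_le _ _⟩,
      (agree_take ha₀ hsched M.m hH hl).eq.symm⟩

/-! ### Age accumulated over time -/

theorem intervalIntegrable_age (a₀ : Fin M.m → ℝ) (sched : M.Scheduler) (H : History)
    (l : Fin M.m) (u v : ℝ) :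
    IntervalIntegrable (M.age a₀ sched H l) MeasureTheory.volume u v := by
  have key : Measurable (M.lastGen a₀ sched H l) ∧ ∃ B, ∀ t, ‖M.lastGen a₀ sched H l t‖ ≤ B := by
    induction H with
    | nil => exact ⟨measurable_const, |a₀ l|, fun t => by simp [lastGen]⟩
    | cons x H ih =>
      obtain ⟨z, y⟩ := x
      obtain ⟨hm, B, hB⟩ := ih
      by_cases hl : l = sched H
      · constructor
        · have : M.lastGen a₀ sched ((z, y) :: H) l = fun t =>
              if t ∈ Set.Ici (deliveryTime ((z, y) :: H)) then deliveryTime H + z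
              else M.lastGen a₀ sched H l t := by
            funext t
            simp only [lastGen, hl, and_true, Set.mem_Ici]
          rw [this]
          exact Measurable.ite measurableSet_Ici measurable_const hm
        · refine ⟨max |deliveryTime H + z| B, fun t => ?_⟩
          simp only [lastGen]
          split_ifs
          · exact le_max_left _ _
          · exact (hB t).trans (le_max_right _ _)
      · have : M.lastGen a₀ sched ((z, y) :: H) l = M.lastGen a₀ sched H l := by
          funext t
          simp only [lastGen, hl, and_false, if_false]
        rw [this]
        exact ⟨hm, B, hB⟩
  obtain ⟨hm, B, hB⟩ := key
  refine (continuous_id.intervalIntegrable u v).sub ?_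
  exact (intervalIntegrable_const (c := B)).mono_fun hm.aestronglyMeasurable
    (Eventually.of_forall fun t => (hB t).trans (le_abs_self B))

/-- The total age accumulated up to the last delivery. -/
noncomputable def totalAge (M : UpdateSystem) (a₀ : Fin M.m → ℝ) (sched : M.Scheduler)
    (H : History) : ℝ :=
  ∑ l : Fin M.m, ∫ t in (0 : ℝ)..deliveryTime H, M.age a₀ sched H l t

theorem totalAge_nil (a₀ : Fin M.m → ℝ) (sched : M.Scheduler) : M.totalAge a₀ sched [] = 0 := by
  simp [totalAge, deliveryTime]

theorem integral_age_cons (a₀ : Fin M.m → ℝ) (sched : M.Scheduler) {H : History} {z y : ℝ}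
    (hH : M.Feasible ((z, y) :: H)) (l : Fin M.m) :
    ∫ t in (0 : ℝ)..deliveryTime ((z, y) :: H), M.age a₀ sched ((z, y) :: H) l t =
      (∫ t in (0 : ℝ)..deliveryTime H, M.age a₀ sched H l t) +
        (M.age a₀ sched H l (deliveryTime H) * (z + y) + (z + y) ^ 2 / 2) := by
  have hD := hH.deliveryTime_nonneg
  obtain ⟨⟨hz, hy⟩, hH⟩ := feasible_cons.1 hH
  have hz := M.𝒵_nonneg z hz
  have hy := M.𝒴_nonneg y hy
  set D := deliveryTime H with hDdef
  set D' := deliveryTime ((z, y) :: H) with hD'def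
  have hD' : D' = D + (z + y) := by
    rw [hD'def, hDdef, deliveryTime, add_assoc]
  have h1 : ∫ t in (0 : ℝ)..D', M.age a₀ sched ((z, y) :: H) l t =
      ∫ t in (0 : ℝ)..D', M.age a₀ sched H l t := by
    -- The new packet changes the age only from the endpoint `D'` on, which the integral does not
    -- see.
    refine intervalIntegral.integral_congr_Ioo_of_le hD fun t ht => ?_
    simp only [age, lastGen]
    rw [if_neg fun h => absurd h.1 (not_le.2 ht.2)]
  rw [h1, ← intervalIntegral.integral_add_adjacent_intervals
    (intervalIntegrable_age a₀ sched H l 0 D) (intervalIntegrable_age a₀ sched H l D D')]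
  congr 1
  have h2 : ∫ t in D..D', M.age a₀ sched H l t =
      ∫ t in D..D', (M.age a₀ sched H l D + (t - D)) := by
    refine intervalIntegral.integral_congr fun t ht => ?_
    rw [Set.uIcc_of_le (by linarith)] at ht
    exact age_of_deliveryTime_le a₀ sched l hH ht.1
  rw [h2, intervalIntegral.integral_add (by simp) (Continuous.intervalIntegrable (by fun_prop) _ _),
    intervalIntegral.integral_sub (by simp) (by simp), integral_id]
  simp only [intervalIntegral.integral_const, smul_eq_mul, hD']
  ring

theorem totalAge_cons {H : History} {z y : ℝ} (hH : M.Feasible ((z, y) :: H)) :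
    M.totalAge a₀ sched ((z, y) :: H) = M.totalAge a₀ sched H +
      ((∑ i, M.state a₀ sched H i) * (z + y) + (M.m : ℝ) / 2 * (z + y) ^ 2) := by
  simp only [totalAge, integral_age_cons a₀ sched hH, Finset.sum_add_distrib, sum_state,
    Finset.sum_mul, Finset.sum_const, Finset.card_univ, Fintype.card_fin, nsmul_eq_mul]
  ring

/-! ### Expectations and drift bounds -/

section Expectation

variable (f : M.Sampler)

/-- The conditional expectation of `F` after one more stage, given the history. -/
noncomputable def oneStep (f : M.Sampler) (F : History → ℝ) (H : History) : ℝ :=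
  ∑ z ∈ M.𝒵, f.prob H z * ∑ y ∈ M.𝒴, M.p y * F ((z, y) :: H)

theorem expect_succ (n : ℕ) (F : History → ℝ) :
    M.expect f (n + 1) F = M.expect f n (oneStep f F) := rfl

theorem oneStep_le {F : History → ℝ} {H : History} {c : ℝ}
    (h : ∀ z ∈ M.𝒵, ∑ y ∈ M.𝒴, M.p y * F ((z, y) :: H) ≤ c) : oneStep f F H ≤ c := by
  calc oneStep f F H ≤ ∑ z ∈ M.𝒵, f.prob H z * c :=
        Finset.sum_le_sum fun z hz => mul_le_mul_of_nonneg_left (h z hz) (f.prob_nonneg H z hz)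
    _ = c := by rw [← Finset.sum_mul, f.prob_sum, one_mul]

theorem le_oneStep {F : History → ℝ} {H : History} {c : ℝ}
    (h : ∀ z ∈ M.𝒵, c ≤ ∑ y ∈ M.𝒴, M.p y * F ((z, y) :: H)) : c ≤ oneStep f F H := by
  calc c = ∑ z ∈ M.𝒵, f.prob H z * c := by rw [← Finset.sum_mul, f.prob_sum, one_mul]
    _ ≤ oneStep f F H :=
        Finset.sum_le_sum fun z hz => mul_le_mul_of_nonneg_left (h z hz) (f.prob_nonneg H z hz)

theorem oneStep_mono {F G : History → ℝ} (h : ∀ H, M.Feasible H → F H ≤ G H) {H : History}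
    (hH : M.Feasible H) : oneStep f F H ≤ oneStep f G H :=
  Finset.sum_le_sum fun z hz => mul_le_mul_of_nonneg_left
    (Finset.sum_le_sum fun y hy => mul_le_mul_of_nonneg_left
      (h _ (feasible_cons.2 ⟨⟨hz, hy⟩, hH⟩)) (M.p_nonneg y hy)) (f.prob_nonneg H z hz)

theorem oneStep_add (F G : History → ℝ) :
    oneStep f (fun H => F H + G H) = fun H => oneStep f F H + oneStep f G H := by
  funext H
  simp only [oneStep, mul_add, Finset.sum_add_distrib]

theorem oneStep_const_mul (c : ℝ) (F : History → ℝ) :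
    oneStep f (fun H => c * F H) = fun H => c * oneStep f F H := by
  funext H
  simp only [oneStep, Finset.mul_sum]
  exact Finset.sum_congr rfl fun z _ => Finset.sum_congr rfl fun y _ => by ring

theorem oneStep_const (c : ℝ) : oneStep f (fun _ => c) = fun _ => c := by
  funext H
  simp only [oneStep, ← Finset.sum_mul, M.p_sum, f.prob_sum, one_mul]

theorem expect_mono (n : ℕ) {F G : History → ℝ} (h : ∀ H, M.Feasible H → F H ≤ G H) :
    M.expect f n F ≤ M.expect f n G := by
  induction n generalizing F G with
  | zero => exact h [] feasible_nil
  | succ n ih => exact ih fun H hH => oneStep_mono f h hH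

theorem expect_add (n : ℕ) (F G : History → ℝ) :
    M.expect f n (fun H => F H + G H) = M.expect f n F + M.expect f n G := by
  induction n generalizing F G with
  | zero => rfl
  | succ n ih => rw [expect_succ, oneStep_add, ih, expect_succ, expect_succ]

theorem expect_const_mul (n : ℕ) (c : ℝ) (F : History → ℝ) :
    M.expect f n (fun H => c * F H) = c * M.expect f n F := by
  induction n generalizing F with
  | zero => rfl
  | succ n ih => rw [expect_succ, oneStep_const_mul, ih, expect_succ]

theorem expect_const (n : ℕ) (c : ℝ) : M.expect f n (fun _ => c) = c := by
  induction n with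
  | zero => rfl
  | succ n ih => rw [expect_succ, oneStep_const, ih]

/-- A conditional drift bound sums over the stages; this serves delivery times, accumulated age and
the potential alike. -/
theorem expect_le_of_oneStep_le {F : History → ℝ} {c : ℝ}
    (h : ∀ H, M.Feasible H → oneStep f F H ≤ F H + c) (n : ℕ) :
    M.expect f n F ≤ F [] + n * c := by
  induction n with
  | zero => simp [expect]
  | succ n ih =>
    have := expect_mono f n h
    rw [expect_add, expect_const] at this
    rw [expect_succ]
    push_cast
    linarith

theorem le_expect_of_le_oneStep {F : History → ℝ} {c : ℝ}
    (h : ∀ H, M.Feasible H → F H + c ≤ oneStep f F H) (n : ℕ) :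
    F [] + n * c ≤ M.expect f n F := by
  induction n with
  | zero => simp [expect]
  | succ n ih =>
    have := expect_mono f n h
    rw [expect_add, expect_const] at this
    rw [expect_succ]
    push_cast
    linarith

theorem sum_p_deliveryTime (H : History) (z : ℝ) :
    ∑ y ∈ M.𝒴, M.p y * deliveryTime ((z, y) :: H) = deliveryTime H + z + M.meanY := by
  simp only [deliveryTime, mul_add, Finset.sum_add_distrib, ← Finset.sum_mul, M.p_sum, one_mul,
    meanY]

theorem le_expect_deliveryTime (n : ℕ) : n * M.meanY ≤ M.expect f n deliveryTime := by
  have := le_expect_of_le_oneStep f (F := deliveryTime) (c := M.meanY) (fun H _ =>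
    le_oneStep f fun z hz => by
      rw [sum_p_deliveryTime]
      linarith [M.𝒵_nonneg z hz]) n
  simpa [deliveryTime] using this

theorem expect_deliveryTime_le {Z : ℝ} (hZ : ∀ z ∈ M.𝒵, z ≤ Z) (n : ℕ) :
    M.expect f n deliveryTime ≤ n * (Z + M.meanY) := by
  have := expect_le_of_oneStep_le f (F := deliveryTime) (c := Z + M.meanY) (fun H _ =>
    oneStep_le f fun z hz => by
      rw [sum_p_deliveryTime]
      linarith [hZ z hz]) n
  simpa [deliveryTime] using this

end Expectation

/-! ### Boundedness of the age ratios -/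

theorem totalAge_nonneg (ha₀ : ∀ l, 0 ≤ a₀ l) : ∀ {H : History}, M.Feasible H →
    0 ≤ M.totalAge a₀ sched H
  | [], _ => (totalAge_nil a₀ sched).ge
  | (z, y) :: H, hH => by
    rw [totalAge_cons hH]
    obtain ⟨⟨hz, hy⟩, hH⟩ := feasible_cons.1 hH
    have hz := M.𝒵_nonneg z hz
    have hy := M.𝒴_nonneg y hy
    have h1 := totalAge_nonneg ha₀ hH
    have h2 : 0 ≤ ∑ i, M.state a₀ sched H i :=
      Finset.sum_nonneg fun i _ => state_nonneg ha₀ hH i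
    positivity

theorem exists_expect_totalAge_le (ha₀ : ∀ l, 0 ≤ a₀ l) (hsched : M.IsMAF a₀ sched) :
    ∃ K : ℝ, 0 ≤ K ∧ ∀ (f : M.Sampler) (n : ℕ),
      M.expect f n (M.totalAge a₀ sched) ≤ n * K := by
  obtain ⟨K, hK⟩ := (((finite_stateSpace ha₀ hsched).prod
    ((M.𝒵 ×ˢ M.𝒴).finite_toSet)).image (fun x : (Fin M.m → ℝ) × (ℝ × ℝ) =>
      (∑ i, x.1 i) * (x.2.1 + x.2.2) + (M.m : ℝ) / 2 * (x.2.1 + x.2.2) ^ 2)).bddAbove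
  refine ⟨max K 0, le_max_right _ _, fun f n => ?_⟩
  have := expect_le_of_oneStep_le f (F := M.totalAge a₀ sched) (c := max K 0) (fun H hH =>
    oneStep_le f fun z hz => ?_) n
  · simpa [totalAge_nil] using this
  · calc ∑ y ∈ M.𝒴, M.p y * M.totalAge a₀ sched ((z, y) :: H)
        ≤ ∑ y ∈ M.𝒴, M.p y * (M.totalAge a₀ sched H + max K 0) := by
          refine Finset.sum_le_sum fun y hy => mul_le_mul_of_nonneg_left ?_ (M.p_nonneg y hy)
          rw [totalAge_cons (feasible_cons.2 ⟨⟨hz, hy⟩, hH⟩)]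
          refine add_le_add le_rfl (le_trans ?_ (le_max_left _ _))
          exact hK ⟨(M.state a₀ sched H, (z, y)), ⟨state_mem_stateSpace hH, by simp [hz, hy]⟩, rfl⟩
      _ = M.totalAge a₀ sched H + max K 0 := by rw [← Finset.sum_mul, M.p_sum, one_mul]

/-- The ratio of which the total average age is the limit superior. -/
noncomputable def ageRatio (M : UpdateSystem) (a₀ : Fin M.m → ℝ) (sched : M.Scheduler)
    (f : M.Sampler) (n : ℕ) : ℝ :=
  M.expect f n (M.totalAge a₀ sched) / M.expect f n deliveryTime

theorem meanY_pos (M : UpdateSystem) : 0 < M.meanY := M.mean_pos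

theorem expect_deliveryTime_nonneg (f : M.Sampler) (n : ℕ) : 0 ≤ M.expect f n deliveryTime :=
  (mul_nonneg n.cast_nonneg M.meanY_pos.le).trans (le_expect_deliveryTime f n)

theorem ageRatio_nonneg (ha₀ : ∀ l, 0 ≤ a₀ l) (f : M.Sampler) (n : ℕ) :
    0 ≤ M.ageRatio a₀ sched f n := by
  refine div_nonneg ?_ (expect_deliveryTime_nonneg f n)
  rw [← expect_const f n 0]
  exact expect_mono f n fun H hH => totalAge_nonneg ha₀ hH

/-- Accumulated age grows at most linearly and expected delivery time at least linearly. The bound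
gives the real-valued limsup its intended meaning. -/
theorem isBoundedUnder_ageRatio (ha₀ : ∀ l, 0 ≤ a₀ l) (hsched : M.IsMAF a₀ sched)
    (f : M.Sampler) : IsBoundedUnder (· ≤ ·) atTop (M.ageRatio a₀ sched f) := by
  obtain ⟨K, hK0, hK⟩ := exists_expect_totalAge_le ha₀ hsched
  refine isBoundedUnder_of ⟨K / M.meanY, fun n => ?_⟩
  have hY := M.meanY_pos
  refine div_le_of_le_mul₀ (expect_deliveryTime_nonneg f n) (by positivity) ?_
  calc M.expect f n (M.totalAge a₀ sched) ≤ n * K := hK f n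
    _ = K / M.meanY * (n * M.meanY) := by field_simp
    _ ≤ _ := mul_le_mul_of_nonneg_left (le_expect_deliveryTime f n) (by positivity)

theorem isCoboundedUnder_ageRatio (ha₀ : ∀ l, 0 ≤ a₀ l) (f : M.Sampler) :
    IsCoboundedUnder (· ≤ ·) atTop (M.ageRatio a₀ sched f) :=
  (isBoundedUnder_of (r := (· ≥ ·)) ⟨0, ageRatio_nonneg ha₀ f⟩).isCoboundedUnder_le

theorem taa_nonneg (ha₀ : ∀ l, 0 ≤ a₀ l) (hsched : M.IsMAF a₀ sched) (f : M.Sampler) :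
    0 ≤ M.taa a₀ sched f :=
  le_limsup_of_frequently_le (Frequently.of_forall (ageRatio_nonneg ha₀ f))
    (isBoundedUnder_ageRatio ha₀ hsched f)

theorem taaOpt_le_taa (ha₀ : ∀ l, 0 ≤ a₀ l) (hsched : M.IsMAF a₀ sched) (f : M.Sampler) :
    M.taaOpt a₀ sched ≤ M.taa a₀ sched f :=
  ciInf_le ⟨0, by rintro _ ⟨g, rfl⟩; exact taa_nonneg ha₀ hsched g⟩ f

/-! ### Dependence of cost and transition on state and wait -/

theorem cost_eq (β : ℝ) (s : Fin M.m → ℝ) (z : ℝ) :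
    M.cost β s z = M.cost β s 0 + z * (∑ l, s l - β + M.m * M.meanY) + M.m / 2 * z ^ 2 := by
  have h : ∀ z, M.cost β s z = ((∑ l, s l - β) * z + M.m / 2 * z ^ 2) * ∑ y ∈ M.𝒴, M.p y +
      ((∑ l, s l - β) + M.m * z) * M.meanY + M.m / 2 * ∑ y ∈ M.𝒴, M.p y * y ^ 2 := by
    intro z
    simp only [cost, meanY, Finset.mul_sum, ← Finset.sum_add_distrib]
    exact Finset.sum_congr rfl fun y _ => by ring
  rw [h z, h 0, M.p_sum]
  ring

theorem cost_mono (β : ℝ) {s s' : Fin M.m → ℝ} (h : s ≤ s') {z : ℝ} (hz : z ∈ M.𝒵) :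
    M.cost β s z ≤ M.cost β s' z := by
  refine Finset.sum_le_sum fun y hy => mul_le_mul_of_nonneg_left ?_ (M.p_nonneg y hy)
  have h1 : ∑ l, s l ≤ ∑ l, s' l := Finset.sum_le_sum fun l _ => h l
  have h2 : 0 ≤ z + y := add_nonneg (M.𝒵_nonneg z hz) (M.𝒴_nonneg y hy)
  gcongr

theorem next_mono {s s' : Fin M.m → ℝ} (h : s ≤ s') {z z' : ℝ} (hz : z ≤ z') (y : ℝ) :
    M.next s z y ≤ M.next s' z' y := by
  intro i
  simp only [next]
  split_ifs with hi
  · have := h ⟨i + 1, hi⟩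
    linarith
  · exact le_rfl

/-! ### Bellman's equation: existence, monotonicity, zero wait -/

section Bellman

variable {β lam : ℝ} {h : (Fin M.m → ℝ) → ℝ}

theorem exists_bellman (ha₀ : ∀ l, 0 ≤ a₀ l) (hsched : M.IsMAF a₀ sched) (β : ℝ) :
    ∃ (lam : ℝ) (h : (Fin M.m → ℝ) → ℝ), M.Bellman β (M.stateSpace a₀ sched) lam h := by
  classical
  set S := M.stateSpace a₀ sched with hS
  have : Fintype S := (finite_stateSpace ha₀ hsched).fintype
  have : Nonempty S := ⟨⟨_, state_mem_stateSpace feasible_nil⟩⟩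
  have : Nonempty M.𝒵 := ⟨⟨0, M.zero_mem⟩⟩
  let T : S → M.𝒵 → M.𝒴 → S := fun s z y =>
    ⟨M.next s z y, next_mem_stateSpace ha₀ hsched s.2 z.2 y.2⟩
  obtain ⟨g, h, hgh⟩ := exists_average_cost_solution (fun (s : S) (z : M.𝒵) => M.cost β s z) T
    (p := fun y : M.𝒴 => M.p y) (fun y => M.p_nonneg y y.2)
    (by rw [Finset.sum_coe_sort M.𝒴 M.p, M.p_sum]) (N := M.m)
    (E := fun k s s' => M.Agree k s s') (fun s s' => agree_zero _ _)
    (fun s s' h => Subtype.ext h.eq) (fun k s s' z y h => h.next z y)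
  -- The value 0 off `S` is immaterial, since transitions stay in `S`.
  let h' : (Fin M.m → ℝ) → ℝ := fun s => if hs : s ∈ S then h ⟨s, hs⟩ else 0
  have hh' : ∀ s : S, h' s = h s := fun s => dif_pos s.2
  have hrhs : ∀ (s : S) (z : M.𝒵), M.bellmanRHS β h' s z =
      M.cost β s z + 1 * ∑ y : M.𝒴, M.p y * h (T s z y) := by
    intro s z
    rw [bellmanRHS, one_mul, ← Finset.sum_coe_sort M.𝒴 (fun y => M.p y * h' (M.next s z y))]
    congr 1
    exact Finset.sum_congr rfl fun y _ => by rw [← hh']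
  refine ⟨g, h', fun s hs => ⟨?_, ?_⟩⟩
  · obtain ⟨z, hz⟩ := exists_dpOperator_eq (c := fun (s : S) (z : M.𝒵) => M.cost β s z) (T := T)
      (p := fun y : M.𝒴 => M.p y) 1 h ⟨s, hs⟩
    refine ⟨z, z.2, ?_⟩
    rw [hrhs ⟨s, hs⟩ z, hh' ⟨s, hs⟩, hgh, hz]
  · rintro _ ⟨z, hz, rfl⟩
    rw [hrhs ⟨s, hs⟩ ⟨z, hz⟩, hh' ⟨s, hs⟩, hgh]
    exact dpOperator_le (c := fun (s : S) (z : M.𝒵) => M.cost β s z) (T := T)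
      (p := fun y : M.𝒴 => M.p y) 1 h ⟨s, hs⟩ ⟨z, hz⟩

/-- Induction on the number `j` of entries not yet known to agree: a common transition preserves the
order and adds one agreeing entry. -/
theorem Bellman.le_of_agree (ha₀ : ∀ l, 0 ≤ a₀ l) (hsched : M.IsMAF a₀ sched)
    (hB : M.Bellman β (M.stateSpace a₀ sched) lam h) (j : ℕ) :
    ∀ k, k + j = M.m → ∀ s ∈ M.stateSpace a₀ sched, ∀ s' ∈ M.stateSpace a₀ sched, s ≤ s' →
      M.Agree k s s' → h s ≤ h s' := by
  induction j with
  | zero =>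
    rintro k hk s - s' - - hss
    rw [add_zero] at hk
    subst hk
    rw [hss.eq]
  | succ j ih =>
    intro k hk s hs s' hs' hle hss
    obtain ⟨z, hz, hzeq⟩ := (hB s' hs').1
    have h1 := (hB s hs).2 ⟨z, hz, rfl⟩
    have h2 : M.bellmanRHS β h s z ≤ M.bellmanRHS β h s' z :=
      add_le_add (cost_mono β hle hz) (Finset.sum_le_sum fun y hy =>
        mul_le_mul_of_nonneg_left (ih (k + 1) (by omega) _
          (next_mem_stateSpace ha₀ hsched hs hz hy) _ (next_mem_stateSpace ha₀ hsched hs' hz hy)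
          (next_mono hle le_rfl y) (hss.next z y)) (M.p_nonneg y hy))
    linarith

/-- Every solution of Bellman's equation is monotone on the state space. -/
theorem Bellman.monotone (ha₀ : ∀ l, 0 ≤ a₀ l) (hsched : M.IsMAF a₀ sched)
    (hB : M.Bellman β (M.stateSpace a₀ sched) lam h) {s s' : Fin M.m → ℝ}
    (hs : s ∈ M.stateSpace a₀ sched) (hs' : s' ∈ M.stateSpace a₀ sched) (hle : s ≤ s') :
    h s ≤ h s' :=
  hB.le_of_agree ha₀ hsched M.m 0 (zero_add _) s hs s' hs' hle (agree_zero s s')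

theorem Bellman.bellmanRHS_zero_lt (ha₀ : ∀ l, 0 ≤ a₀ l) (hsched : M.IsMAF a₀ sched)
    (hB : M.Bellman β (M.stateSpace a₀ sched) lam h) {s : Fin M.m → ℝ}
    (hs : s ∈ M.stateSpace a₀ sched) (hA : β - M.m * M.meanY ≤ ∑ l, s l) {z : ℝ}
    (hz : z ∈ M.𝒵) (hz0 : z ≠ 0) : M.bellmanRHS β h s 0 < M.bellmanRHS β h s z := by
  have hzpos : 0 < z := lt_of_le_of_ne (M.𝒵_nonneg z hz) hz0.symm
  refine add_lt_add_of_lt_of_le ?_ (Finset.sum_le_sum fun y hy => mul_le_mul_of_nonneg_left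
    (hB.monotone ha₀ hsched (next_mem_stateSpace ha₀ hsched hs M.zero_mem hy)
      (next_mem_stateSpace ha₀ hsched hs hz hy) (next_mono le_rfl hzpos.le y)) (M.p_nonneg y hy))
  have hm : (0 : ℝ) < M.m := by exact_mod_cast M.m_pos
  have h1 : 0 ≤ z * (∑ l, s l - β + M.m * M.meanY) := mul_nonneg hzpos.le (by linarith)
  have h2 : 0 < (M.m : ℝ) / 2 * z ^ 2 := by positivity
  rw [cost_eq β s z]
  linarith

/-! ### Drift of the potential and optimality -/

/-- The accumulated excess of age over the rate `β`, corrected by the relative value. -/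
noncomputable def potential (M : UpdateSystem) (a₀ : Fin M.m → ℝ) (sched : M.Scheduler) (β : ℝ)
    (h : (Fin M.m → ℝ) → ℝ) (H : History) : ℝ :=
  M.totalAge a₀ sched H + (-β) * deliveryTime H + h (M.state a₀ sched H)

theorem sum_p_potential (ha₀ : ∀ l, 0 ≤ a₀ l) (hsched : M.IsMAF a₀ sched) (β : ℝ)
    (h : (Fin M.m → ℝ) → ℝ) {H : History} (hH : M.Feasible H) {z : ℝ} (hz : z ∈ M.𝒵) :
    ∑ y ∈ M.𝒴, M.p y * M.potential a₀ sched β h ((z, y) :: H) =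
      M.potential a₀ sched β h H - h (M.state a₀ sched H) +
        M.bellmanRHS β h (M.state a₀ sched H) z := by
  set s := M.state a₀ sched H with hs
  have h1 : ∀ y ∈ M.𝒴, M.p y * M.potential a₀ sched β h ((z, y) :: H) =
      M.p y * (M.totalAge a₀ sched H + (-β) * deliveryTime H) +
        (M.p y * ((∑ l, s l - β) * (z + y) + (M.m : ℝ) / 2 * (z ^ 2 + 2 * z * y + y ^ 2)) +
          M.p y * h (M.next s z y)) := by
    intro y hy
    have hH' : M.Feasible ((z, y) :: H) := feasible_cons.2 ⟨⟨hz, hy⟩, hH⟩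
    rw [potential, totalAge_cons hH', state_cons ha₀ hsched hH', deliveryTime, ← hs]
    ring
  rw [Finset.sum_congr rfl h1, Finset.sum_add_distrib, Finset.sum_add_distrib, ← Finset.sum_mul,
    M.p_sum, one_mul, potential, bellmanRHS, cost]
  ring

theorem expect_potential (f : M.Sampler) (n : ℕ) :
    M.expect f n (M.potential a₀ sched β h) = M.expect f n (M.totalAge a₀ sched) -
      β * M.expect f n deliveryTime + M.expect f n (fun H => h (M.state a₀ sched H)) := by
  unfold potential
  rw [expect_add, expect_add, expect_const_mul]
  ring

theorem exists_abs_le_on_stateSpace (ha₀ : ∀ l, 0 ≤ a₀ l) (hsched : M.IsMAF a₀ sched)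
    (h : (Fin M.m → ℝ) → ℝ) : ∃ B : ℝ, ∀ s ∈ M.stateSpace a₀ sched, |h s| ≤ B := by
  obtain ⟨B, hB⟩ := ((finite_stateSpace ha₀ hsched).image fun s => |h s|).bddAbove
  exact ⟨B, fun s hs => hB ⟨s, hs, rfl⟩⟩

theorem abs_expect_state_le {B : ℝ} (hB : ∀ s ∈ M.stateSpace a₀ sched, |h s| ≤ B)
    (f : M.Sampler) (n : ℕ) : |M.expect f n (fun H => h (M.state a₀ sched H))| ≤ B := by
  rw [abs_le]
  constructor
  · rw [← expect_const f n (-B)]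
    exact expect_mono f n fun H hH => (abs_le.1 (hB _ (state_mem_stateSpace hH))).1
  · conv_rhs => rw [← expect_const f n B]
    exact expect_mono f n fun H hH => (abs_le.1 (hB _ (state_mem_stateSpace hH))).2

theorem potential_nil (a₀ : Fin M.m → ℝ) (sched : M.Scheduler) (β : ℝ)
    (h : (Fin M.m → ℝ) → ℝ) :
    M.potential a₀ sched β h [] = h (M.state a₀ sched []) := by
  simp [potential, totalAge_nil, deliveryTime]

/-- No wait beats the Bellman minimum, so the potential gains at least `lam` per stage; `2 * B` pays
for `h` at the initial and final states. -/
theorem Bellman.le_expect_totalAge (ha₀ : ∀ l, 0 ≤ a₀ l) (hsched : M.IsMAF a₀ sched)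
    (hB : M.Bellman β (M.stateSpace a₀ sched) lam h) {B : ℝ}
    (hhB : ∀ s ∈ M.stateSpace a₀ sched, |h s| ≤ B) (f : M.Sampler) (n : ℕ) :
    β * M.expect f n deliveryTime + n * lam - 2 * B ≤ M.expect f n (M.totalAge a₀ sched) := by
  have h1 := le_expect_of_le_oneStep f (F := M.potential a₀ sched β h) (c := lam) (fun H hH =>
    le_oneStep f fun z hz => by
      rw [sum_p_potential ha₀ hsched β h hH hz]
      have := (hB _ (state_mem_stateSpace hH)).2 ⟨z, hz, rfl⟩
      linarith) n
  rw [expect_potential, potential_nil] at h1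
  have h2 := abs_le.1 (abs_expect_state_le hhB f n)
  have h3 := abs_le.1 (hhB _ (state_mem_stateSpace (feasible_nil (M := M))))
  linarith

theorem Bellman.expect_totalAge_le (ha₀ : ∀ l, 0 ≤ a₀ l) (hsched : M.IsMAF a₀ sched)
    (hB : M.Bellman β (M.stateSpace a₀ sched) lam h) {B : ℝ}
    (hhB : ∀ s ∈ M.stateSpace a₀ sched, |h s| ≤ B) {μ : (Fin M.m → ℝ) → {z : ℝ // z ∈ M.𝒵}}
    (hμ : ∀ s ∈ M.stateSpace a₀ sched, M.IsOptimalWait β h s (μ s)) (n : ℕ) :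
    M.expect (M.stationary a₀ sched μ) n (M.totalAge a₀ sched) ≤
      β * M.expect (M.stationary a₀ sched μ) n deliveryTime + n * lam + 2 * B := by
  have h1 := expect_le_of_oneStep_le (M.stationary a₀ sched μ) (F := M.potential a₀ sched β h)
    (c := lam) (fun H hH => ?_) n
  · rw [expect_potential, potential_nil] at h1
    have h2 := abs_le.1 (abs_expect_state_le hhB (M.stationary a₀ sched μ) n)
    have h3 := abs_le.1 (hhB _ (state_mem_stateSpace (feasible_nil (M := M))))
    linarith
  · have hs := state_mem_stateSpace (a₀ := a₀) (sched := sched) hH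
    have h1 : oneStep (M.stationary a₀ sched μ) (M.potential a₀ sched β h) H =
        ∑ y ∈ M.𝒴, M.p y *
          M.potential a₀ sched β h (((μ (M.state a₀ sched H) : ℝ), y) :: H) := by
      simp only [oneStep, stationary, ite_mul, one_mul, zero_mul]
      rw [Finset.sum_ite_eq' M.𝒵, if_pos (μ _).2]
    rw [h1, sum_p_potential ha₀ hsched β h hH (μ _).2]
    obtain ⟨z, hz, hzeq⟩ := (hB _ hs).1
    have := (hμ _ hs).2 z hz
    linarith

/-- With the optimal total average age as parameter, the constant in Bellman's equation is
nonpositive. -/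
theorem Bellman.lam_nonpos (ha₀ : ∀ l, 0 ≤ a₀ l) (hsched : M.IsMAF a₀ sched)
    (hB : M.Bellman (M.taaOpt a₀ sched) (M.stateSpace a₀ sched) lam h) : lam ≤ 0 := by
  by_contra! hlam
  set β := M.taaOpt a₀ sched with hβ
  obtain ⟨B, hhB⟩ := exists_abs_le_on_stateSpace ha₀ hsched h
  obtain ⟨Z, hZ⟩ := M.𝒵.finite_toSet.bddAbove
  have hZ' : ∀ z ∈ M.𝒵, z ≤ Z := fun z hz => hZ hz
  have hY := M.meanY_pos
  have hW : 0 < Z + M.meanY := by linarith [hZ' 0 M.zero_mem]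
  -- For large `n`, half of `n * lam` absorbs the error `2 * B`; the other half is a surplus per
  -- unit time, as the expected delivery time is at most `n * (Z + E[Y])`.
  have hlow : ∀ f : M.Sampler, β + lam / 2 / (Z + M.meanY) ≤ M.taa a₀ sched f := by
    intro f
    refine le_limsup_of_frequently_le (Eventually.frequently ?_)
      (isBoundedUnder_ageRatio ha₀ hsched f)
    obtain ⟨N, hN⟩ := exists_nat_gt (4 * B / lam)
    filter_upwards [eventually_ge_atTop (max N 1)] with n hn
    have hn1 : (1 : ℝ) ≤ n := by exact_mod_cast (le_max_right _ _).trans hn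
    have hnN : (N : ℝ) ≤ n := by exact_mod_cast (le_max_left _ _).trans hn
    have hnB : 4 * B ≤ n * lam := by
      rw [div_lt_iff₀ hlam] at hN
      nlinarith
    have hD := le_expect_deliveryTime f n
    have hD' := expect_deliveryTime_le f hZ' n
    have hDpos : 0 < M.expect f n deliveryTime := lt_of_lt_of_le (by positivity) hD
    have hJ := hB.le_expect_totalAge ha₀ hsched hhB f n
    rw [le_div_iff₀ hDpos, add_mul]
    have : lam / 2 / (Z + M.meanY) * M.expect f n deliveryTime ≤ n * lam / 2 := by
      calc lam / 2 / (Z + M.meanY) * M.expect f n deliveryTime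
          ≤ lam / 2 / (Z + M.meanY) * (n * (Z + M.meanY)) :=
            mul_le_mul_of_nonneg_left hD' (by positivity)
        _ = n * lam / 2 := by field_simp
    change _ ≤ M.expect f n (M.totalAge a₀ sched)
    linarith
  have : Nonempty M.Sampler := ⟨M.stationary a₀ sched fun _ => ⟨0, M.zero_mem⟩⟩
  have h1 : β + lam / 2 / (Z + M.meanY) ≤ β := le_ciInf hlow
  have h2 : 0 < lam / 2 / (Z + M.meanY) := by positivity
  linarith

theorem Bellman.isOptimalSampler_stationary (ha₀ : ∀ l, 0 ≤ a₀ l) (hsched : M.IsMAF a₀ sched)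
    (hB : M.Bellman (M.taaOpt a₀ sched) (M.stateSpace a₀ sched) lam h)
    {μ : (Fin M.m → ℝ) → {z : ℝ // z ∈ M.𝒵}}
    (hμ : ∀ s ∈ M.stateSpace a₀ sched, M.IsOptimalWait (M.taaOpt a₀ sched) h s (μ s)) :
    M.IsOptimalSampler a₀ sched (M.stationary a₀ sched μ) := by
  intro g
  refine le_trans ?_ (taaOpt_le_taa ha₀ hsched g)
  set f := M.stationary a₀ sched μ
  obtain ⟨B, hhB⟩ := exists_abs_le_on_stateSpace ha₀ hsched h
  -- Since `lam ≤ 0`, the ratio exceeds `β` by at most `2 * B` over the expected delivery time,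
  -- which is below `ε` eventually.
  refine le_of_forall_pos_le_add fun ε hε => ?_
  refine limsup_le_of_le (isCoboundedUnder_ageRatio ha₀ f) ?_
  have hY := M.meanY_pos
  obtain ⟨N, hN⟩ := exists_nat_gt (2 * B / (ε * M.meanY))
  filter_upwards [eventually_ge_atTop (max N 1)] with n hn
  have hn1 : (1 : ℝ) ≤ n := by exact_mod_cast (le_max_right _ _).trans hn
  have hnN : (N : ℝ) ≤ n := by exact_mod_cast (le_max_left _ _).trans hn
  have hnB : 2 * B ≤ ε * (n * M.meanY) := by
    rw [div_lt_iff₀ (by positivity)] at hN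
    have : (N : ℝ) * (ε * M.meanY) ≤ n * (ε * M.meanY) :=
      mul_le_mul_of_nonneg_right hnN (by positivity)
    linarith
  have hD := le_expect_deliveryTime f n
  have hDpos : 0 < M.expect f n deliveryTime := lt_of_lt_of_le (by positivity) hD
  have hJ := hB.expect_totalAge_le ha₀ hsched hhB hμ n
  have hlam : n * lam ≤ 0 :=
    mul_nonpos_of_nonneg_of_nonpos n.cast_nonneg (hB.lam_nonpos ha₀ hsched)
  rw [div_le_iff₀ hDpos, add_mul]
  have := mul_le_mul_of_nonneg_left hD hε.le
  change M.expect f n (M.totalAge a₀ sched) ≤ _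
  linarith

end Bellman

end UpdateSystem

theorem proposition4 (M : UpdateSystem) (a₀ : Fin M.m → ℝ) (ha₀ : ∀ l, 0 ≤ a₀ l)
    (sched : M.Scheduler) (hsched : M.IsMAF a₀ sched) :
    (∃ (lam : ℝ) (h : (Fin M.m → ℝ) → ℝ),
      M.Bellman (M.taaOpt a₀ sched) (M.stateSpace a₀ sched) lam h) ∧
    ∀ (lam : ℝ) (h : (Fin M.m → ℝ) → ℝ),
      M.Bellman (M.taaOpt a₀ sched) (M.stateSpace a₀ sched) lam h →
      (∀ μ : (Fin M.m → ℝ) → {z : ℝ // z ∈ M.𝒵},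
        (∀ s ∈ M.stateSpace a₀ sched, M.IsOptimalWait (M.taaOpt a₀ sched) h s (μ s)) →
        M.IsOptimalSampler a₀ sched (M.stationary a₀ sched μ)) ∧
      ∀ s ∈ M.stateSpace a₀ sched,
        M.taaOpt a₀ sched - (M.m : ℝ) * M.meanY ≤ ∑ l, s l →
        ∀ z : ℝ, M.IsOptimalWait (M.taaOpt a₀ sched) h s z ↔ z = 0 := by
  refine ⟨UpdateSystem.exists_bellman ha₀ hsched _, fun lam h hB =>
    ⟨fun μ hμ => hB.isOptimalSampler_stationary ha₀ hsched hμ, fun s hs hA z => ⟨?_, ?_⟩⟩⟩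
  · rintro ⟨hz, hmin⟩
    by_contra hz0
    exact absurd (hmin 0 M.zero_mem)
      (not_le.2 (hB.bellmanRHS_zero_lt ha₀ hsched hs hA hz hz0))
  · rintro rfl
    refine ⟨M.zero_mem, fun w hw => ?_⟩
    rcases eq_or_ne w 0 with rfl | hw0
    · exact le_rfl
    · exact (hB.bellmanRHS_zero_lt ha₀ hsched hs hA hw hw0).le
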